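/- Let $A$ be a finite-dimensional commutative associative unital $\mathbb{C}$-algebra with Jacobson radical $\mathfrak{J}$. Let $S$ be a Wedderburn--Malcev semisimple part of $A$, that is, a semisimple subalgebra with $A = S \oplus \mathfrak{J}$ as vector spaces. Let $\mathfrak{g}$ be a finite-dimensional complex Lie algebra whose center $\mathfrak{z}(\mathfrak{g})$ is contained in $[\mathfrak{g},\mathfrak{g}]$, and suppose that the Lie algebra $\operatorname{Der}(A)$ of derivations of $A$ is solvable. By a Levi factor of a finite-dimensional Lie algebra we mean a semisimple Lie subalgebra that is a vector space complement of the solvable radical. Let $\mathfrak{s}$ be a Levi factor of $\operatorname{Der}(\mathfrak{g})$. Let $\mathfrak{g}\otimes A$ carry the bracket $[x\otimes a, y\otimes b] = [x,y]\otimes ab$. For $D \in \operatorname{Der}(\mathfrak{g})$ and $a \in A$ let $D\otimes a$ act on $\mathfrak{g}\otimes A$ as the derivation $x\otimes b \mapsto D(x)\otimes ab$. Then the resulting homomorphism of Lie algebras $\mathfrak{s}\otimes S \to \operatorname{Der}(\mathfrak{g}\otimes A)$ is injective, and its image, again denoted $\mathfrak{s}\otimes S$, is a Levi factor of $\operatorname{Der}(\mathfrak{g}\otimes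 A)$. -/

import Mathlib

open scoped TensorProduct

namespace CurrentLie

/-- A Levi factor (Levi complement) of a Lie algebra `L`: a semisimple Lie subalgebra which is a
vector space complement of the solvable radical of `L`. -/
structure IsLeviFactor {K L : Type*} [Field K] [LieRing L] [LieAlgebra K L]
    (𝔰 : LieSubalgebra K L) : Prop where
  isSemisimple : LieAlgebra.IsSemisimple K 𝔰
  isCompl : IsCompl 𝔰.toSubmodule (LieAlgebra.radical K L).toSubmodule

/-- A Wedderburn–Malcev part of a commutative algebra `A`: a semisimple subalgebra which is a
vector space complement of the Jacobson radical of `A`. -/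
structure IsWedderburnMalcevPart {K A : Type*} [Field K] [CommRing A] [Algebra K A]
    (S : Subalgebra K A) : Prop where
  isSemisimpleRing : IsSemisimpleRing S
  isCompl : IsCompl (Subalgebra.toSubmodule S) ((Ring.jacobson A).restrictScalars K)

section

variable {K A L : Type*} [Field K] [CommRing A] [Algebra K A] [LieRing L] [LieAlgebra K L]

/-- For `a : A` and a derivation `D` of `L`, the derivation `b ⊗ x ↦ (a * b) ⊗ D x` of the current
Lie algebra `A ⊗ L`. -/
def tmulDer (a : A) (D : LieDerivation K L L) : LieDerivation K (A ⊗[K] L) (A ⊗[K] L) where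
  toLinearMap := TensorProduct.map (LinearMap.mulLeft K a) D.toLinearMap
  leibniz' x y := by
    induction x using TensorProduct.induction_on with
    | zero => simp
    | add x₁ x₂ h₁ h₂ => simp only [add_lie, map_add, lie_add, h₁, h₂]; abel
    | tmul b u =>
      induction y using TensorProduct.induction_on with
      | zero => simp
      | add y₁ y₂ h₁ h₂ => simp only [add_lie, map_add, lie_add, h₁, h₂]; abel
      | tmul c v =>
        simp [LieAlgebra.ExtendScalars.bracket_tmul, TensorProduct.tmul_sub, mul_left_comm,
          mul_comm]

@[simp]
theorem tmulDer_tmul (a b : A) (D : LieDerivation K L L) (x : L) :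
    tmulDer a D (b ⊗ₜ[K] x) = (a * b) ⊗ₜ[K] D x := rfl

theorem der_ext {D E : LieDerivation K (A ⊗[K] L) (A ⊗[K] L)}
    (h : ∀ (b : A) (x : L), D (b ⊗ₜ[K] x) = E (b ⊗ₜ[K] x)) : D = E := by
  ext z
  induction z using TensorProduct.induction_on with
  | zero => simp
  | add x y hx hy => simp only [map_add, hx, hy]
  | tmul b x => exact h b x

variable (K A L) in
/-- The canonical homomorphism of Lie algebras `A ⊗ Der L → Der (A ⊗ L)`, which sends `a ⊗ D` to
the derivation `b ⊗ x ↦ (a * b) ⊗ D x`. -/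
noncomputable def tensorDer :
    A ⊗[K] LieDerivation K L L →ₗ⁅K⁆ LieDerivation K (A ⊗[K] L) (A ⊗[K] L) where
  toLinearMap := TensorProduct.lift <| LinearMap.mk₂ K tmulDer
    (fun a b D => der_ext fun c x => by simp [add_mul, TensorProduct.add_tmul])
    (fun r a D => der_ext fun c x => by simp [TensorProduct.smul_tmul'])
    (fun a D E => der_ext fun c x => by simp [TensorProduct.tmul_add])
    (fun r a D => der_ext fun c x => by simp [TensorProduct.tmul_smul])
  map_lie' {x y} := by
    induction x using TensorProduct.induction_on with
    | zero => simp
    | add x₁ x₂ h₁ h₂ => simp_all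
    | tmul a D =>
      induction y using TensorProduct.induction_on with
      | zero => simp
      | add y₁ y₂ h₁ h₂ => simp_all
      | tmul b E =>
        refine der_ext fun c x => ?_
        simp [LieAlgebra.ExtendScalars.bracket_tmul, TensorProduct.tmul_sub, mul_assoc,
          mul_left_comm]

/-- The canonical homomorphism of Lie algebras `S ⊗ 𝔰 → A ⊗ Der L → Der (A ⊗ L)` for a subalgebra
`S` of `A` and a Lie subalgebra `𝔰` of `Der L`; it realizes `S ⊗ 𝔰` inside `Der (A ⊗ L)`. -/
noncomputable def tensorDerRestrict (S : Subalgebra K A)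
    (𝔰 : LieSubalgebra K (LieDerivation K L L)) :
    S ⊗[K] 𝔰 →ₗ⁅K⁆ LieDerivation K (A ⊗[K] L) (A ⊗[K] L) :=
  (tensorDer K A L).comp (LieAlgebra.ExtendScalars.map S.val 𝔰.incl)

/-- It sends `a ⊗ D` to the derivation `b ⊗ x ↦ (a * b) ⊗ D x`. -/
theorem tensorDerRestrict_tmul (S : Subalgebra K A) (𝔰 : LieSubalgebra K (LieDerivation K L L))
    (a : S) (D : 𝔰) (b : A) (x : L) :
    tensorDerRestrict S 𝔰 (a ⊗ₜ[K] D) (b ⊗ₜ[K] x) =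
      ((a : A) * b) ⊗ₜ[K] (D : LieDerivation K L L) x := rfl

end

end CurrentLie

/-! Write J for the nilradical of A (also its Jacobson radical), Z for the center of L, 𝔯 for the
radical of Der L, and N = `centralDer` for the derivations of A ⊗ L with values in J ⊗ L + A ⊗ Z.
The core is that Der(A ⊗ L) = A ⊗ Der L + N with N a solvable ideal.

A derivation differs from the A-linear extension of its restriction to 1 ⊗ L by its `defect`. On A ⊗
[L, L] the defect is a sum of operators d ⊗ b with d in Der A and b in the centroid
(`exists_defect_eq_sum`), and d maps A into J (`derivation_apply_mem_nilradical`). Bracketing with 1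
⊗ L then shows that every defect lies in J ⊗ L + A ⊗ Z.

N is solvable (`solvableChain_centralDer`) for three reasons. Centroid elements commute on [L, L],
so modulo operators raising the J-adic filtration of A ⊗ [L, L], iterated brackets in N follow the
derived series of Der A. The raising operators die out because J is nilpotent. What remains vanishes
on A ⊗ [L, L] and, after further brackets, takes values in A ⊗ Z ⊆ A ⊗ [L, L], so that composites
are zero.

Now A = S + J and Der L = 𝔰 + 𝔯 give Der(A ⊗ L) = S ⊗ 𝔰 + (A ⊗ 𝔯 + N), and A ⊗ 𝔯 + N is a solvable
ideal (`isSolvable_radicalDer`). The characters of S embed S ⊗ 𝔰 into a product of copies of 𝔰, so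
it has trivial radical and meets the radical of Der(A ⊗ L) in zero. -/

namespace CurrentLie

/-! ### Derivations of commutative algebras and the nilradical -/

open Polynomial in
/-- A derivation over a field of characteristic zero maps nilpotent elements to nilpotent elements. -/
theorem isNilpotent_derivation_apply {K A : Type*} [Field K] [CharZero K] [CommRing A]
    [Algebra K A] (d : Derivation K A A) {x : A} (hx : IsNilpotent x) : IsNilpotent (d x) := by
  obtain ⟨n, hn⟩ := hx
  -- With y = d x, differentiate x ^ (m + 1) * y ^ (2 * k) = 0 and multiply by y: the term
  -- containing d y is a multiple of the original equation, which leaves (m + 1) * x ^ m * y ^ (2 *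
  -- k + 2) = 0.
  have key : ∀ k ≤ n, x ^ (n - k) * d x ^ (2 * k) = 0 := by
    intro k
    induction k with
    | zero => simpa using hn
    | succ k ih =>
      intro hk
      obtain ⟨m, rfl⟩ : ∃ m, n = m + 1 + k := ⟨n - k - 1, by omega⟩
      have h0 := ih (by omega)
      rw [show m + 1 + k - k = m + 1 by omega] at h0
      rw [show m + 1 + k - (k + 1) = m by omega]
      have h1 := congrArg d h0
      simp only [Derivation.leibniz, Derivation.leibniz_pow, map_zero, smul_eq_mul,
        nsmul_eq_mul] at h1
      have h2 : ((m + 1 : ℕ) : A) * (x ^ m * d x ^ (2 * (k + 1))) = 0 := by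
        rcases k with _ | k
        · simp only [mul_zero, pow_zero, Nat.cast_zero, zero_mul, one_mul, zero_add,
            Nat.add_sub_cancel] at h1
          linear_combination d x * h1
        · rw [show 2 * (k + 1) - 1 = 2 * k + 1 by omega, Nat.add_sub_cancel] at h1
          linear_combination d x * h1 - (2 * (k + 1) : ℕ) * d (d x) * h0
      have hu : IsUnit ((m + 1 : ℕ) : A) := by
        have : ((m + 1 : ℕ) : A) = algebraMap K A ((m + 1 : ℕ) : K) := by simp
        rw [this]
        exact (IsUnit.mk0 _ (Nat.cast_ne_zero.mpr (Nat.succ_ne_zero m))).map _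
      exact hu.mul_right_eq_zero.mp h2
  have := key n le_rfl
  simp only [Nat.sub_self, pow_zero, one_mul] at this
  exact ⟨_, this⟩

open Polynomial UniqueFactorizationMonoid in
/-- A derivation of a commutative algebra which is integral over a field of characteristic zero
takes nilpotent values. -/
theorem derivation_apply_mem_nilradical {K A : Type*} [Field K] [CharZero K] [CommRing A]
    [Algebra K A] [Algebra.IsIntegral K A] (d : Derivation K A A) (a : A) :
    d a ∈ nilradical A := by
  classical
  have hint : IsIntegral K a := Algebra.IsIntegral.isIntegral a
  set q := radical (minpoly K a)
  obtain ⟨n, hn⟩ := exists_dvd_radical_self_pow (minpoly.ne_zero hint)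
  have hq : aeval a q ∈ nilradical A := by
    refine ⟨n, ?_⟩
    obtain ⟨r, hr⟩ := hn
    rw [← map_pow, hr]
    simp
  -- Separability makes q'(a) invertible modulo the nilradical, while q'(a) * d a = d (q(a)) is
  -- nilpotent.
  have hsep : q.Separable := PerfectField.separable_iff_squarefree.mpr squarefree_radical
  have hdq : aeval a (derivative q) * d a ∈ nilradical A := by
    rw [← smul_eq_mul, ← Derivation.map_aeval]
    exact isNilpotent_derivation_apply d hq
  obtain ⟨u, v, huv⟩ := hsep
  have h1 : aeval a u * aeval a q + aeval a v * aeval a (derivative q) = 1 := by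
    simpa using congrArg (aeval a) huv
  have : d a = (aeval a u * d a) * aeval a q + aeval a v * (aeval a (derivative q) * d a) := by
    linear_combination (-d a) * h1
  rw [this]
  exact add_mem (Ideal.mul_mem_left _ _ hq) (Ideal.mul_mem_left _ _ hdq)

theorem derivation_apply_mem_nilradical_pow {K A : Type*} [Field K] [CharZero K] [CommRing A]
    [Algebra K A] [Algebra.IsIntegral K A] (d : Derivation K A A) (p : ℕ) {a : A}
    (ha : a ∈ nilradical A ^ p) : d a ∈ nilradical A ^ p := by
  induction p generalizing a with
  | zero => simp
  | succ p ih =>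
    rw [pow_succ] at ha ⊢
    induction ha using Submodule.mul_induction_on' with
    | mem_mul_mem m hm n hn =>
      rw [Derivation.leibniz, smul_eq_mul, smul_eq_mul, mul_comm n]
      exact add_mem (Ideal.mul_mem_mul hm (derivation_apply_mem_nilradical d n))
        (Ideal.mul_mem_mul (ih hm) hn)
    | add x _ y _ hx hy => rw [map_add]; exact add_mem hx hy

/-! ### Slices and subspaces of a tensor product -/

section Slice

variable {K A L : Type*} [Field K] [CommRing A] [Algebra K A] [LieRing L] [LieAlgebra K L]

/-- Evaluation of a functional of `A` on the first tensor factor of `A ⊗ L`. -/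
noncomputable def slice (μ : Module.Dual K A) : A ⊗[K] L →ₗ[K] L :=
  (TensorProduct.lid K L).toLinearMap ∘ₗ LinearMap.rTensor L μ

@[simp]
theorem slice_tmul (μ : Module.Dual K A) (a : A) (x : L) : slice μ (a ⊗ₜ[K] x) = μ a • x := by
  simp [slice]

theorem slice_rTensor (μ : Module.Dual K A) (f : A →ₗ[K] A) (z : A ⊗[K] L) :
    slice μ (LinearMap.rTensor L f z) = slice (μ ∘ₗ f) z := by
  induction z using TensorProduct.induction_on with
  | zero => simp
  | add x y hx hy => simp only [map_add, hx, hy]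
  | tmul a x => simp

theorem slice_lie_one_tmul (μ : Module.Dual K A) (z : A ⊗[K] L) (y : L) :
    slice μ ⁅z, (1 : A) ⊗ₜ[K] y⁆ = ⁅slice μ z, y⁆ := by
  induction z using TensorProduct.induction_on with
  | zero => simp
  | add u v hu hv => simp only [map_add, add_lie, hu, hv]
  | tmul a x => simp [LieAlgebra.ExtendScalars.bracket_tmul]

theorem slice_one_tmul_lie (μ : Module.Dual K A) (z : A ⊗[K] L) (y : L) :
    slice μ ⁅(1 : A) ⊗ₜ[K] y, z⁆ = ⁅y, slice μ z⁆ := by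
  rw [← lie_skew, map_neg, slice_lie_one_tmul, lie_skew]

theorem sum_tmul_slice_coord {ι : Type*} [Fintype ι] (e : Module.Basis ι K A) (z : A ⊗[K] L) :
    ∑ i, e i ⊗ₜ[K] slice (e.coord i) z = z := by
  induction z using TensorProduct.induction_on with
  | zero => simp
  | add u v hu hv => simp only [map_add, TensorProduct.tmul_add, Finset.sum_add_distrib, hu, hv]
  | tmul a x =>
    simp only [slice_tmul, ← TensorProduct.smul_tmul, ← TensorProduct.sum_tmul,
      Module.Basis.coord_apply, e.sum_repr]

/-- The subspace `I ⊗ W` of `A ⊗ L`. -/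
noncomputable abbrev tensorSub (I : Submodule K A) (W : Submodule K L) : Submodule K (A ⊗[K] L) :=
  Submodule.map₂ (TensorProduct.mk K A L) I W

theorem tmul_mem_tensorSub {I : Submodule K A} {W : Submodule K L} {a : A} {x : L} (ha : a ∈ I)
    (hx : x ∈ W) : a ⊗ₜ[K] x ∈ tensorSub I W :=
  Submodule.apply_mem_map₂ (TensorProduct.mk K A L) ha hx

theorem tensorSub_le {I : Submodule K A} {W : Submodule K L} {V : Submodule K (A ⊗[K] L)} :
    tensorSub I W ≤ V ↔ ∀ a ∈ I, ∀ x ∈ W, a ⊗ₜ[K] x ∈ V :=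
  Submodule.map₂_le

theorem tensorSub_top_top : tensorSub (⊤ : Submodule K A) (⊤ : Submodule K L) = ⊤ := by
  rw [eq_top_iff]
  intro z _
  induction z using TensorProduct.induction_on with
  | zero => exact zero_mem _
  | add u v hu hv => exact add_mem (hu trivial) (hv trivial)
  | tmul a x => exact tmul_mem_tensorSub trivial trivial

theorem slice_mem_of_mem_tensorSub {I : Submodule K A} {W : Submodule K L} {z : A ⊗[K] L}
    (hz : z ∈ tensorSub I W) (μ : Module.Dual K A) : slice μ z ∈ W := by
  have : tensorSub I W ≤ W.comap (slice μ) := tensorSub_le.mpr fun a _ x hx => by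
    simpa using W.smul_mem _ hx
  exact this hz

theorem slice_eq_zero_of_mem_tensorSub {I : Submodule K A} {W : Submodule K L} {z : A ⊗[K] L}
    (hz : z ∈ tensorSub I W) {μ : Module.Dual K A} (hμ : ∀ a ∈ I, μ a = 0) : slice μ z = 0 := by
  have : tensorSub I W ≤ LinearMap.ker (slice μ) := tensorSub_le.mpr fun a ha x _ => by
    simp [hμ a ha]
  exact this hz

theorem exists_projection (I : Submodule K A) :
    ∃ π : A →ₗ[K] A, (∀ a ∈ I, π a = 0) ∧ ∀ a, a - π a ∈ I := by
  obtain ⟨g, hg⟩ := I.mkQ.exists_rightInverse_of_surjective (by simp)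
  refine ⟨g ∘ₗ I.mkQ, fun a ha => ?_, fun a => ?_⟩
  · have : I.mkQ a = 0 := by simpa using ha
    rw [LinearMap.comp_apply, this, map_zero]
  · rw [← Submodule.Quotient.mk_eq_zero, Submodule.Quotient.mk_sub, sub_eq_zero]
    exact (LinearMap.congr_fun hg (I.mkQ a)).symm

variable [FiniteDimensional K A]

/-- Take a projection π of A with kernel I. Then z - (π ⊗ 1) z lies in I ⊗ L, and the slices of (π ⊗
1) z are slices of z along functionals that vanish on I. -/
theorem mem_tensorSub_top_sup_iff {I : Submodule K A} {W : Submodule K L} {z : A ⊗[K] L} :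
    z ∈ tensorSub I ⊤ ⊔ tensorSub ⊤ W ↔
      ∀ μ : Module.Dual K A, (∀ a ∈ I, μ a = 0) → slice μ z ∈ W := by
  constructor
  · intro hz μ hμ
    obtain ⟨u, hu, v, hv, rfl⟩ := Submodule.mem_sup.mp hz
    rw [map_add, slice_eq_zero_of_mem_tensorSub hu hμ, zero_add]
    exact slice_mem_of_mem_tensorSub hv μ
  · intro h
    obtain ⟨π, hπ, hπ'⟩ := exists_projection I
    let e := Module.finBasis K A
    have h1 : LinearMap.rTensor L π z ∈ tensorSub ⊤ W := by
      rw [← sum_tmul_slice_coord e (LinearMap.rTensor L π z)]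
      refine sum_mem fun i _ => tmul_mem_tensorSub trivial ?_
      rw [slice_rTensor]
      exact h _ fun a ha => by simp [hπ a ha]
    have h2 : z - LinearMap.rTensor L π z ∈ tensorSub I ⊤ := by
      have : z - LinearMap.rTensor L π z = ∑ i, (e i - π (e i)) ⊗ₜ[K] slice (e.coord i) z := by
        conv_lhs => rw [← sum_tmul_slice_coord e z]
        simp [TensorProduct.sub_tmul, Finset.sum_sub_distrib]
      rw [this]
      exact sum_mem fun i _ => tmul_mem_tensorSub (hπ' _) trivial
    rw [← sub_add_cancel z (LinearMap.rTensor L π z)]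
    exact Submodule.add_mem_sup h2 h1

theorem eq_zero_of_slice {z : A ⊗[K] L} (h : ∀ μ : Module.Dual K A, slice μ z = 0) : z = 0 := by
  rw [← sum_tmul_slice_coord (Module.finBasis K A) z]
  simp [h]

end Slice

/-! ### The centroid and the failure of A-linearity -/

section Defect

variable {K A L : Type*} [Field K] [CommRing A] [Algebra K A] [LieRing L] [LieAlgebra K L]

variable (K L) in
/-- The derived subalgebra `[L, L]` as a subspace. -/
abbrev derivedSub : Submodule K L := (⁅(⊤ : LieIdeal K L), (⊤ : LieIdeal K L)⁆).toSubmodule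

variable (K L) in
/-- The center as a subspace. -/
abbrev centerSub : Submodule K L := (LieAlgebra.center K L).toSubmodule

theorem mem_centerSub {z : L} : z ∈ centerSub K L ↔ ∀ y : L, ⁅z, y⁆ = 0 := by
  refine (LieModule.mem_maxTrivSubmodule K L L z).trans (forall_congr' fun y => ?_)
  rw [← lie_skew, neg_eq_zero]

theorem lie_mem_derivedSub (x y : L) : ⁅x, y⁆ ∈ derivedSub K L :=
  LieSubmodule.lie_mem_lie (LieSubmodule.mem_top x) (LieSubmodule.mem_top y)

theorem derivedSub_le {W : Submodule K L} (h : ∀ x y : L, ⁅x, y⁆ ∈ W) : derivedSub K L ≤ W := by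
  rw [derivedSub, LieSubmodule.lieIdeal_oper_eq_linear_span', Submodule.span_le]
  rintro _ ⟨x, -, y, -, rfl⟩
  exact h x y

theorem eqOn_derivedSub {M : Type*} [AddCommGroup M] [Module K M] {f g : L →ₗ[K] M}
    (h : ∀ x y : L, f ⁅x, y⁆ = g ⁅x, y⁆) {v : L} (hv : v ∈ derivedSub K L) : f v = g v :=
  have : derivedSub K L ≤ LinearMap.eqLocus f g := derivedSub_le h
  this hv

variable (K L) in
/-- The centroid of a Lie algebra. -/
def centroid : Submodule K (L →ₗ[K] L) where
  carrier := {b | ∀ x y, b ⁅x, y⁆ = ⁅b x, y⁆}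
  add_mem' hb hc x y := by simp [hb x y, hc x y]
  zero_mem' x y := by simp
  smul_mem' r b hb x y := by simp [hb x y]

theorem centroid_apply_lie {b : L →ₗ[K] L} (hb : b ∈ centroid K L) (x y : L) :
    b ⁅x, y⁆ = ⁅x, b y⁆ := by
  rw [← lie_skew, map_neg, hb y x, lie_skew]

theorem centroid_mem_derivedSub {b : L →ₗ[K] L} (hb : b ∈ centroid K L) {v : L}
    (hv : v ∈ derivedSub K L) : b v ∈ derivedSub K L := by
  refine derivedSub_le (W := (derivedSub K L).comap b) (fun x y => ?_) hv
  rw [Submodule.mem_comap, hb x y]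
  exact lie_mem_derivedSub _ _

theorem centroid_mul_mem {b c : L →ₗ[K] L} (hb : b ∈ centroid K L) (hc : c ∈ centroid K L) :
    b ∘ₗ c ∈ centroid K L := fun x y => by
  rw [LinearMap.comp_apply, hc x y, hb, LinearMap.comp_apply]

/-- On a bracket, b and c can act on different arguments, and there the order does not matter. -/
theorem centroid_comm {b c : L →ₗ[K] L} (hb : b ∈ centroid K L) (hc : c ∈ centroid K L) {v : L}
    (hv : v ∈ derivedSub K L) : b (c v) = c (b v) := by
  refine eqOn_derivedSub (f := b ∘ₗ c) (g := c ∘ₗ b) (fun x y => ?_) hv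
  simp only [LinearMap.comp_apply]
  rw [hc x y, centroid_apply_lie hb, centroid_apply_lie hb x y, hc]

/-- The bilinear map `(a, x) ↦ D (a ⊗ x) - a • D (1 ⊗ x)` which measures the failure of a
derivation `D` of `A ⊗ L` to be `A`-linear. -/
noncomputable def defect (D : LieDerivation K (A ⊗[K] L) (A ⊗[K] L)) :
    A →ₗ[K] L →ₗ[K] A ⊗[K] L :=
  LinearMap.mk₂ K (fun a x => D (a ⊗ₜ[K] x) - a • D ((1 : A) ⊗ₜ[K] x))
    (fun a b x => by rw [TensorProduct.add_tmul, map_add, add_smul]; abel)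
    (fun r a x => by rw [← TensorProduct.smul_tmul', map_smul, smul_assoc, smul_sub])
    (fun a x y => by simp only [TensorProduct.tmul_add, map_add, smul_add]; abel)
    (fun r a x => by
      simp only [TensorProduct.tmul_smul, map_smul]
      rw [smul_comm a r, smul_sub])

/-- The derivation of `L` obtained from a derivation of `A ⊗ L` by restriction to `1 ⊗ L` and
evaluation of a functional on the first tensor factor. -/
noncomputable def sliceDer (μ : Module.Dual K A) (D : LieDerivation K (A ⊗[K] L) (A ⊗[K] L)) :
    LieDerivation K L L where
  toLinearMap := slice μ ∘ₗ (D : A ⊗[K] L →ₗ[K] A ⊗[K] L) ∘ₗ TensorProduct.mk K A L 1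
  leibniz' x y := by
    have h := D.apply_lie_eq_sub ((1 : A) ⊗ₜ[K] x) ((1 : A) ⊗ₜ[K] y)
    rw [LieAlgebra.ExtendScalars.bracket_tmul, mul_one] at h
    have h' := congrArg (slice μ) h
    rw [map_sub, slice_one_tmul_lie, slice_one_tmul_lie] at h'
    exact h'

theorem sliceDer_apply (μ : Module.Dual K A) (D : LieDerivation K (A ⊗[K] L) (A ⊗[K] L)) (x : L) :
    sliceDer μ D x = slice μ (D ((1 : A) ⊗ₜ[K] x)) := rfl

variable (D : LieDerivation K (A ⊗[K] L) (A ⊗[K] L))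

theorem defect_apply (a : A) (x : L) :
    defect D a x = D (a ⊗ₜ[K] x) - a • D ((1 : A) ⊗ₜ[K] x) := rfl

theorem apply_tmul_eq (a : A) (x : L) :
    D (a ⊗ₜ[K] x) = a • D ((1 : A) ⊗ₜ[K] x) + defect D a x := by
  rw [defect_apply]; abel

theorem tmul_eq_smul (a : A) (x : L) : a ⊗ₜ[K] x = a • ((1 : A) ⊗ₜ[K] x) := by
  rw [TensorProduct.smul_tmul', smul_eq_mul, mul_one]

theorem apply_tmul_lie (a b : A) (x y : L) :
    D ((a * b) ⊗ₜ[K] ⁅x, y⁆) =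
      b • ⁅D (a ⊗ₜ[K] x), (1 : A) ⊗ₜ[K] y⁆ + a • ⁅(1 : A) ⊗ₜ[K] x, D (b ⊗ₜ[K] y)⁆ := by
  rw [← LieAlgebra.ExtendScalars.bracket_tmul, LieDerivation.apply_lie_eq_add, tmul_eq_smul b y,
    tmul_eq_smul a x, smul_lie, lie_smul, add_comm]

/-- The terms in which D acts on 1 ⊗ y cancel by A-bilinearity of the bracket. This is what places
the slices of the defect in the centroid. -/
theorem defect_lie (a : A) (x y : L) :
    defect D a ⁅x, y⁆ = ⁅defect D a x, (1 : A) ⊗ₜ[K] y⁆ := by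
  have h1 := apply_tmul_lie D a 1 x y
  have h2 := apply_tmul_lie D 1 1 x y
  rw [mul_one, one_smul] at h1
  rw [mul_one, one_smul, one_smul] at h2
  rw [defect_apply, h1, h2, defect_apply, sub_lie, smul_lie, smul_add]
  abel

theorem defect_mul_lie (a b : A) (x y : L) :
    defect D (a * b) ⁅x, y⁆ = a • defect D b ⁅x, y⁆ + b • defect D a ⁅x, y⁆ := by
  have h0 := apply_tmul_lie D a b x y
  have h1 := apply_tmul_lie D a 1 x y
  have h2 := apply_tmul_lie D 1 b x y
  have h3 := apply_tmul_lie D 1 1 x y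
  simp only [mul_one, one_mul, one_smul] at h1 h2 h3
  simp only [defect_apply, h0, h1, h2, h3, smul_sub, smul_add, mul_smul, smul_comm b a]
  abel

theorem defect_mul (a b : A) {v : L} (hv : v ∈ derivedSub K L) :
    defect D (a * b) v = a • defect D b v + b • defect D a v := by
  refine eqOn_derivedSub (f := defect D (a * b))
    (g := (LinearMap.lsmul A (A ⊗[K] L) a).restrictScalars K ∘ₗ defect D b +
      (LinearMap.lsmul A (A ⊗[K] L) b).restrictScalars K ∘ₗ defect D a) (fun x y => ?_) hv
  simpa using defect_mul_lie D a b x y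

theorem slice_defect_mem_centroid (μ : Module.Dual K A) (a : A) :
    slice μ ∘ₗ defect D a ∈ centroid K L := fun x y => by
  simp only [LinearMap.comp_apply]
  rw [defect_lie, slice_lie_one_tmul]

variable [FiniteDimensional K A] [FiniteDimensional K L]

/-- On `A ⊗ [L, L]`, the defect of a derivation of `A ⊗ L` is a sum of tensor products of
derivations of `A` with elements of the centroid of `L`. -/
theorem exists_defect_eq_sum :
    ∃ (n : ℕ) (d : Fin n → Derivation K A A) (b : Fin n → L →ₗ[K] L),
      (∀ j, b j ∈ centroid K L) ∧
        ∀ a, ∀ v ∈ derivedSub K L, defect D a v = ∑ j, d j a ⊗ₜ[K] b j v := by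
  let e := Module.finBasis K A
  let β (i) : A →ₗ[K] centroid K L :=
    { toFun := fun a => ⟨slice (e.coord i) ∘ₗ defect D a, slice_defect_mem_centroid D _ a⟩
      map_add' := fun a b => by ext; simp
      map_smul' := fun r a => by ext; simp }
  -- Only restrictions to [L, L] are seen by the Leibniz rule `defect_mul`; a basis of the space of
  -- restrictions makes the coefficients unique.
  let R : centroid K L →ₗ[K] (derivedSub K L →ₗ[K] L) :=
    LinearMap.lcomp K L (derivedSub K L).subtype ∘ₗ (centroid K L).subtype
  have hR (c : centroid K L) (v : derivedSub K L) : R c v = c.1 v := rfl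
  let c := Module.finBasis K (LinearMap.range R)
  choose b hb using fun j => (c j).2
  let γ (i j) : A →ₗ[K] K := c.coord j ∘ₗ R.rangeRestrict ∘ₗ β i
  let d₀ (j) : A →ₗ[K] A := ∑ i, (γ i j).smulRight (e i)
  have hdef : ∀ a, ∀ v ∈ derivedSub K L, defect D a v = ∑ j, d₀ j a ⊗ₜ[K] (b j).1 v := by
    intro a v hv
    have h1 (i) : slice (e.coord i) (defect D a v) = ∑ j, γ i j a • (b j).1 v := by
      have h2 : R (β i a) = ∑ j, γ i j a • R (b j) := by
        have := congrArg Subtype.val (c.sum_repr (R.rangeRestrict (β i a)))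
        rw [Submodule.coe_sum] at this
        simp only [Submodule.coe_smul, ← hb] at this
        exact this.symm
      have h3 := LinearMap.congr_fun h2 ⟨v, hv⟩
      rw [hR] at h3
      rw [LinearMap.sum_apply] at h3
      exact h3
    rw [← sum_tmul_slice_coord e (defect D a v)]
    simp only [h1, TensorProduct.tmul_sum, d₀, LinearMap.sum_apply, LinearMap.smulRight_apply,
      TensorProduct.sum_tmul, TensorProduct.smul_tmul]
    exact Finset.sum_comm
  -- Uniqueness of coefficients carries the Leibniz rule from the defect over to each `d₀ j`.
  have hindep : ∀ f : Fin _ → A, (∀ v ∈ derivedSub K L, ∑ j, f j ⊗ₜ[K] (b j).1 v = 0) →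
      ∀ j, f j = 0 := by
    intro f hf j
    apply (Module.forall_dual_apply_eq_zero_iff K (f j)).mp
    intro μ
    have h1 : ∑ j, μ (f j) • R (b j) = 0 := by
      ext v
      have := congrArg (slice μ) (hf v v.2)
      simp only [map_sum, slice_tmul, map_zero] at this
      rw [LinearMap.sum_apply]
      exact this
    have h2 : ∑ j, μ (f j) • c j = 0 := by
      apply Subtype.ext
      rw [Submodule.coe_sum]
      simp only [Submodule.coe_smul, ← hb]
      exact h1
    exact Fintype.linearIndependent_iff.mp c.linearIndependent _ h2 j
  refine ⟨_, fun j => Derivation.mk' (d₀ j) fun x y => ?_, fun j => (b j).1, fun j => (b j).2,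
    hdef⟩
  have := hindep (fun j => d₀ j (x * y) - (x * d₀ j y + y * d₀ j x)) (fun v hv => ?_) j
  · simpa [sub_eq_zero] using this
  · have h1 := defect_mul D x y hv
    rw [hdef _ v hv, hdef _ v hv, hdef _ v hv, Finset.smul_sum, Finset.smul_sum] at h1
    simp only [TensorProduct.smul_tmul', smul_eq_mul] at h1
    simp only [TensorProduct.sub_tmul, TensorProduct.add_tmul, Finset.sum_sub_distrib,
      Finset.sum_add_distrib, h1, sub_self]

end Defect

/-! ### Solvability through chains of subspaces -/

section Solvability

variable {K P : Type*} [Field K] [LieRing P] [LieAlgebra K P]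

/-- A subspace of a Lie algebra is the first term of a chain of subspaces ending in zero, in which
the brackets of elements of each term lie in the next one. -/
inductive SolvableChain : Submodule K P → Prop
  | bot : SolvableChain ⊥
  | step {U V : Submodule K P} (hV : SolvableChain V) (h : ∀ x ∈ U, ∀ y ∈ U, ⁅x, y⁆ ∈ V) :
      SolvableChain U

theorem SolvableChain.mono {U V : Submodule K P} (hV : SolvableChain V) (h : U ≤ V) :
    SolvableChain U := by
  induction hV with
  | bot => rw [le_bot_iff.mp h]; exact .bot
  | step hV' hV'' _ => exact .step hV' fun x hx y hy => hV'' x (h hx) y (h hy)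

theorem SolvableChain.of_sequence {U : ℕ → Submodule K P} {n : ℕ} (hn : SolvableChain (U n))
    (h : ∀ k, ∀ x ∈ U k, ∀ y ∈ U k, ⁅x, y⁆ ∈ U (k + 1)) : SolvableChain (U 0) := by
  induction n with
  | zero => exact hn
  | succ n ih => exact ih (.step hn (h n))

/-- Terms of the chain need not be subalgebras, so the induction replaces I by ⁅I, I⁆, which is
spanned by brackets and hence lies in the next term. -/
theorem SolvableChain.isSolvable {U : Submodule K P} (hU : SolvableChain U) (I : LieIdeal K P)
    (hI : I.toSubmodule ≤ U) : LieAlgebra.IsSolvable I := by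
  suffices h : ∃ k, LieAlgebra.derivedSeriesOfIdeal K P k I = ⊥ by
    obtain ⟨k, hk⟩ := h
    exact LieAlgebra.IsSolvable.mk (R := K) ((LieIdeal.derivedSeries_eq_bot_iff I k).mpr hk)
  induction hU generalizing I with
  | bot =>
    refine ⟨0, ?_⟩
    rw [LieAlgebra.derivedSeriesOfIdeal_zero, ← LieSubmodule.toSubmodule_eq_bot]
    exact le_bot_iff.mp hI
  | @step U V _ hV ih =>
    obtain ⟨k, hk⟩ := ih ⁅I, I⁆ (by
      rw [LieSubmodule.lieIdeal_oper_eq_linear_span', Submodule.span_le]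
      rintro _ ⟨x, hx, y, hy, rfl⟩
      exact hV x (hI hx) y (hI hy))
    refine ⟨k + 1, ?_⟩
    rwa [LieAlgebra.derivedSeriesOfIdeal_add, LieAlgebra.derivedSeriesOfIdeal_succ,
      LieAlgebra.derivedSeriesOfIdeal_zero]

end Solvability

/-! ### The filtration by J ^ p ⊗ L + A ⊗ Z(L) -/

section Filtration

variable {K A L : Type*} [Field K] [CommRing A] [Algebra K A] [LieRing L] [LieAlgebra K L]

variable (K A) in
/-- The powers of the nilradical as subspaces. -/
abbrev nilPow (p : ℕ) : Submodule K A := (nilradical A ^ p).restrictScalars K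

theorem mem_nilPow {p : ℕ} {a : A} : a ∈ nilPow K A p ↔ a ∈ nilradical A ^ p := Iff.rfl

theorem nilPow_zero : nilPow K A 0 = ⊤ := by
  ext; simp

variable (K A L) in
/-- The subspace `J ^ p ⊗ L + A ⊗ Z(L)` of `A ⊗ L`, with `J` the nilradical of `A`. -/
noncomputable def centralFil (p : ℕ) : Submodule K (A ⊗[K] L) :=
  tensorSub (nilPow K A p) ⊤ ⊔ tensorSub ⊤ (centerSub K L)

theorem smul_mem_tensorSub {p q : ℕ} {W : Submodule K L} {a : A} {z : A ⊗[K] L}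
    (ha : a ∈ nilPow K A p) (hz : z ∈ tensorSub (nilPow K A q) W) :
    a • z ∈ tensorSub (nilPow K A (p + q)) W := by
  have : tensorSub (nilPow K A q) W ≤ (tensorSub (nilPow K A (p + q)) W).comap
      ((LinearMap.lsmul A (A ⊗[K] L) a).restrictScalars K) :=
    tensorSub_le.mpr fun b hb x hx => by
      simp only [Submodule.mem_comap, LinearMap.restrictScalars_apply, LinearMap.lsmul_apply,
        TensorProduct.smul_tmul']
      refine tmul_mem_tensorSub ?_ hx
      rw [mem_nilPow, pow_add, smul_eq_mul]
      exact Ideal.mul_mem_mul ha hb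
  exact this hz

theorem tensorSub_nilPow_anti {p q : ℕ} (h : p ≤ q) (W : Submodule K L) :
    tensorSub (nilPow K A q) W ≤ tensorSub (nilPow K A p) W :=
  tensorSub_le.mpr fun _ ha _ hx => tmul_mem_tensorSub (Ideal.pow_le_pow_right h ha) hx

theorem centralFil_anti {p q : ℕ} (h : p ≤ q) : centralFil K A L q ≤ centralFil K A L p :=
  sup_le_sup_right (tensorSub_nilPow_anti h _) _

theorem centralFil_zero : centralFil K A L 0 = ⊤ := by
  rw [centralFil, nilPow_zero, tensorSub_top_top, top_sup_eq]

theorem smul_mem_centralFil {p q : ℕ} {a : A} {z : A ⊗[K] L}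
    (ha : a ∈ nilPow K A p) (hz : z ∈ centralFil K A L q) : a • z ∈ centralFil K A L (p + q) := by
  obtain ⟨u, hu, v, hv, rfl⟩ := Submodule.mem_sup.mp hz
  rw [smul_add]
  refine Submodule.add_mem_sup (smul_mem_tensorSub ha hu) ?_
  have h0 : v ∈ tensorSub (nilPow K A 0) (centerSub K L) := by rwa [nilPow_zero]
  have h1 := smul_mem_tensorSub (p := 0) (a := a) (by simp) h0
  rwa [add_zero, nilPow_zero] at h1

theorem lie_eq_zero_of_mem_tensorSub_center {I : Submodule K A} {z : A ⊗[K] L}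
    (hz : z ∈ tensorSub I (centerSub K L)) (w : A ⊗[K] L) : ⁅z, w⁆ = 0 := by
  induction w using TensorProduct.induction_on with
  | zero => simp
  | add u v hu hv => rw [lie_add, hu, hv, add_zero]
  | tmul b y =>
    have : tensorSub I (centerSub K L) ≤
        LinearMap.ker (LieAlgebra.ad K (A ⊗[K] L) (b ⊗ₜ[K] y)) :=
      tensorSub_le.mpr fun a _ x hx => by
        rw [LinearMap.mem_ker, LieAlgebra.ad_apply, LieAlgebra.ExtendScalars.bracket_tmul,
          ← lie_skew, mem_centerSub.mp hx, neg_zero, TensorProduct.tmul_zero]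
    rw [← lie_skew, neg_eq_zero]
    exact this hz

theorem lie_mem_of_mem_centralFil {p : ℕ} {z : A ⊗[K] L} (hz : z ∈ centralFil K A L p)
    (w : A ⊗[K] L) : ⁅z, w⁆ ∈ tensorSub (nilPow K A p) (derivedSub K L) := by
  obtain ⟨u, hu, v, hv, rfl⟩ := Submodule.mem_sup.mp hz
  rw [add_lie, lie_eq_zero_of_mem_tensorSub_center hv, add_zero]
  clear hz hv
  induction w using TensorProduct.induction_on with
  | zero => simp
  | add u v hu hv => rw [lie_add]; exact add_mem hu hv
  | tmul b y =>
    have : tensorSub (nilPow K A p) (⊤ : Submodule K L) ≤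
        (tensorSub (nilPow K A p) (derivedSub K L)).comap
          (LieAlgebra.ad K (A ⊗[K] L) (b ⊗ₜ[K] y)) :=
      tensorSub_le.mpr fun a ha x _ => by
        rw [Submodule.mem_comap, LieAlgebra.ad_apply, LieAlgebra.ExtendScalars.bracket_tmul]
        exact tmul_mem_tensorSub (Ideal.mul_mem_left _ b ha) (lie_mem_derivedSub _ _)
    rw [← lie_skew]
    exact neg_mem (this hu)

variable [FiniteDimensional K A]

theorem mem_centralFil_iff {p : ℕ} {z : A ⊗[K] L} :
    z ∈ centralFil K A L p ↔
      ∀ μ : Module.Dual K A, (∀ a ∈ nilPow K A p, μ a = 0) → slice μ z ∈ centerSub K L :=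
  mem_tensorSub_top_sup_iff

/-- An element belongs to `J ^ p ⊗ L + A ⊗ Z(L)` if its brackets with `1 ⊗ L` lie in
`J ^ p ⊗ L`. -/
theorem mem_centralFil_of_lie {p : ℕ} {z : A ⊗[K] L}
    (h : ∀ y : L, ⁅z, (1 : A) ⊗ₜ[K] y⁆ ∈ tensorSub (nilPow K A p) (⊤ : Submodule K L)) :
    z ∈ centralFil K A L p := by
  rw [mem_centralFil_iff]
  intro μ hμ
  rw [mem_centerSub]
  intro y
  rw [← slice_lie_one_tmul]
  exact slice_eq_zero_of_mem_tensorSub (h y) hμ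

/-- D z brackets to zero with 1 ⊗ L because z is central, so there is no constraint on p. -/
theorem map_center_mem_centralFil (D : LieDerivation K (A ⊗[K] L) (A ⊗[K] L)) {z : A ⊗[K] L}
    (hz : z ∈ tensorSub ⊤ (centerSub K L)) (p : ℕ) :
    D z ∈ centralFil K A L p :=
  mem_centralFil_of_lie fun y => by
    have h := LieDerivation.apply_lie_eq_add D z ((1 : A) ⊗ₜ[K] y)
    rw [lie_eq_zero_of_mem_tensorSub_center hz, lie_eq_zero_of_mem_tensorSub_center hz, map_zero,
      zero_add] at h
    rw [← h]
    exact zero_mem _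

end Filtration

/-! ### Derivations modulo the ideal N -/

section DerivationFiltration

variable {K A L : Type*} [Field K] [CharZero K] [CommRing A] [Algebra K A] [FiniteDimensional K A]
  [LieRing L] [LieAlgebra K L] [FiniteDimensional K L]

variable (D : LieDerivation K (A ⊗[K] L) (A ⊗[K] L))

theorem defect_mem_tensorSub_one (a : A) {v : L} (hv : v ∈ derivedSub K L) :
    defect D a v ∈ tensorSub (nilPow K A 1) (derivedSub K L) := by
  obtain ⟨n, d, b, hb, h⟩ := exists_defect_eq_sum D
  rw [h a v hv]
  refine sum_mem fun j _ => tmul_mem_tensorSub ?_ (centroid_mem_derivedSub (hb j) hv)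
  rw [mem_nilPow, pow_one]
  exact derivation_apply_mem_nilradical (d j) a

/-- Here x need not lie in [L, L]; bracketing with 1 ⊗ y replaces it by ⁅x, y⁆, which does. -/
theorem defect_mem_centralFil (a : A) (x : L) : defect D a x ∈ centralFil K A L 1 :=
  mem_centralFil_of_lie fun y => by
    rw [← defect_lie]
    exact Submodule.map₂_le_map₂_right le_top
      (defect_mem_tensorSub_one D a (lie_mem_derivedSub x y))

/-- Every derivation of `A ⊗ L` preserves the ideal `J ⊗ L + A ⊗ Z(L)`. -/
theorem map_mem_centralFil_one {z : A ⊗[K] L} (hz : z ∈ centralFil K A L 1) :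
    D z ∈ centralFil K A L 1 := by
  obtain ⟨u, hu, v, hv, rfl⟩ := Submodule.mem_sup.mp hz
  rw [map_add]
  refine add_mem ?_ (map_center_mem_centralFil D hv 1)
  have : tensorSub (nilPow K A 1) ⊤ ≤ (centralFil K A L 1).comap (D : A ⊗[K] L →ₗ[K] A ⊗[K] L) :=
    tensorSub_le.mpr fun a ha x _ => by
      change D (a ⊗ₜ[K] x) ∈ centralFil K A L 1
      rw [apply_tmul_eq]
      refine add_mem ?_ (defect_mem_centralFil D a x)
      exact smul_mem_centralFil (q := 0) ha (by rw [centralFil_zero]; trivial)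
  exact this hu

variable (K A L) in
/-- The ideal of those derivations of `A ⊗ L` which take values in `J ⊗ L + A ⊗ Z(L)`, with `J`
the nilradical of `A`. -/
def centralDer : LieIdeal K (LieDerivation K (A ⊗[K] L) (A ⊗[K] L)) where
  carrier := {D | ∀ z, D z ∈ centralFil K A L 1}
  add_mem' hD hE z := add_mem (hD z) (hE z)
  zero_mem' z := zero_mem _
  smul_mem' r D hD z := Submodule.smul_mem _ r (hD z)
  lie_mem {E D} hD z := by
    rw [LieDerivation.lie_apply]
    exact sub_mem (map_mem_centralFil_one E (hD z)) (hD (E z))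

theorem tmulDer_mem_centralDer {a : A} (ha : a ∈ nilPow K A 1) (D : LieDerivation K L L) :
    tmulDer a D ∈ centralDer K A L := by
  intro z
  induction z using TensorProduct.induction_on with
  | zero => rw [map_zero]; exact zero_mem _
  | add u v hu hv => rw [map_add]; exact add_mem hu hv
  | tmul b x =>
    rw [tmulDer_tmul, mul_comm]
    exact Submodule.mem_sup_left (tmul_mem_tensorSub (Ideal.mul_mem_left _ b ha) trivial)

/-- The sum is the A-linear extension of D restricted to 1 ⊗ L, so the difference is the defect. -/
theorem sub_sum_mem_centralDer {ι : Type*} [Fintype ι] (e : Module.Basis ι K A) :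
    D - ∑ i, tmulDer (e i) (sliceDer (e.coord i) D) ∈ centralDer K A L := by
  set E := ∑ i, tmulDer (e i) (sliceDer (e.coord i) D) with hE
  have hEa (a : A) (x : L) : E (a ⊗ₜ[K] x) = a • D ((1 : A) ⊗ₜ[K] x) := by
    have h1 : E (a ⊗ₜ[K] x) = ∑ i, tmulDer (e i) (sliceDer (e.coord i) D) (a ⊗ₜ[K] x) := by
      rw [hE, ← LieDerivation.coeFnAddMonoidHom_apply, map_sum, Finset.sum_apply]
      rfl
    rw [h1]
    conv_rhs => rw [← sum_tmul_slice_coord e (D ((1 : A) ⊗ₜ[K] x)), Finset.smul_sum]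
    refine Finset.sum_congr rfl fun i _ => ?_
    rw [tmulDer_tmul, sliceDer_apply, TensorProduct.smul_tmul', smul_eq_mul, mul_comm]
  intro z
  induction z using TensorProduct.induction_on with
  | zero => rw [map_zero]; exact zero_mem _
  | add u v hu hv => rw [map_add]; exact add_mem hu hv
  | tmul a x =>
    rw [LieDerivation.sub_apply, hEa, ← defect_apply]
    exact defect_mem_centralFil D a x

end DerivationFiltration

/-! ### Solvability of N -/

section CentralDerSolvable

variable {K A L : Type*} [Field K] [CommRing A] [Algebra K A] [LieRing L] [LieAlgebra K L]

variable (K A L) in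
/-- The operators which raise the filtration of `A ⊗ [L, L]` by the powers of the nilradical of `A`
by `k` steps. -/
def shiftSub (k : ℕ) : Submodule K (Module.End K (A ⊗[K] L)) where
  carrier := {f | ∀ p, ∀ z ∈ tensorSub (nilPow K A p) (derivedSub K L),
    f z ∈ tensorSub (nilPow K A (p + k)) (derivedSub K L)}
  add_mem' hf hg p z hz := add_mem (hf p z hz) (hg p z hz)
  zero_mem' _ _ _ := zero_mem _
  smul_mem' r _ hf p z hz := Submodule.smul_mem _ r (hf p z hz)

theorem mul_mem_shiftSub {j k : ℕ} {f g : Module.End K (A ⊗[K] L)} (hf : f ∈ shiftSub K A L j)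
    (hg : g ∈ shiftSub K A L k) : f * g ∈ shiftSub K A L (j + k) := fun p z hz => by
  have := hf _ _ (hg p z hz)
  rwa [add_assoc, add_comm k j] at this

theorem shiftSub_anti {j k : ℕ} (h : j ≤ k) : shiftSub K A L k ≤ shiftSub K A L j :=
  fun _ hf p z hz => tensorSub_nilPow_anti (by omega) _ (hf p z hz)

theorem commutator_mem_shiftSub {j k : ℕ} {f g : Module.End K (A ⊗[K] L)}
    (hf : f ∈ shiftSub K A L j) (hg : g ∈ shiftSub K A L k) :
    f * g - g * f ∈ shiftSub K A L (j + k) :=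
  sub_mem (mul_mem_shiftSub hf hg) (add_comm j k ▸ mul_mem_shiftSub hg hf)

theorem mem_shiftSub_of_eq_zero {f : Module.End K (A ⊗[K] L)}
    (hf : ∀ a : A, ∀ v ∈ derivedSub K L, f (a ⊗ₜ[K] v) = 0) (k : ℕ) : f ∈ shiftSub K A L k := by
  intro p z hz
  have : tensorSub (nilPow K A p) (derivedSub K L) ≤ LinearMap.ker f :=
    tensorSub_le.mpr fun a _ v hv => hf a v hv
  rw [LinearMap.mem_ker.mp (this hz)]
  exact zero_mem _

variable (K A L) in
/-- The span of the operators `d ⊗ b`, where `d` is in the `k`-th derived algebra of `Der A` and `b`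
is in the centroid of `L`. -/
noncomputable def derCentroidSub (k : ℕ) : Submodule K (Module.End K (A ⊗[K] L)) :=
  Submodule.span K {f | ∃ d ∈ LieAlgebra.derivedSeries K (Derivation K A A) k,
    ∃ b ∈ centroid K L, f = TensorProduct.map (d : A →ₗ[K] A) b}

theorem commutator_mem_derCentroidSub {k : ℕ} {f g : Module.End K (A ⊗[K] L)}
    (hf : f ∈ derCentroidSub K A L k) (hg : g ∈ derCentroidSub K A L k) :
    f * g - g * f ∈ derCentroidSub K A L (k + 1) ⊔ shiftSub K A L 1 := by
  induction hf using Submodule.span_induction with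
  | zero => simp
  | add f f' _ _ hf hf' => rw [add_mul, mul_add, add_sub_add_comm]; exact add_mem hf hf'
  | smul r f _ hf =>
    rw [smul_mul_assoc, mul_smul_comm, ← smul_sub]; exact Submodule.smul_mem _ r hf
  | mem f hf =>
    induction hg using Submodule.span_induction with
    | zero => simp
    | add g g' _ _ hg hg' => rw [add_mul, mul_add, add_sub_add_comm]; exact add_mem hg hg'
    | smul r f _ hf =>
      rw [smul_mul_assoc, mul_smul_comm, ← smul_sub]; exact Submodule.smul_mem _ r hf
    | mem g hg =>
      obtain ⟨d, hd, b, hb, rfl⟩ := hf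
      obtain ⟨d', hd', b', hb', rfl⟩ := hg
      have h0 : ⁅d, d'⁆ ∈ LieAlgebra.derivedSeries K (Derivation K A A) (k + 1) := by
        rw [LieAlgebra.derivedSeries_def, LieAlgebra.derivedSeriesOfIdeal_succ]
        exact LieSubmodule.lie_mem_lie hd hd'
      have h1 : TensorProduct.map ((⁅d, d'⁆ : Derivation K A A) : A →ₗ[K] A) (b ∘ₗ b') ∈
          derCentroidSub K A L (k + 1) :=
        Submodule.subset_span ⟨_, h0, _, centroid_mul_mem hb hb', rfl⟩
      -- The commutator agrees with [d, d'] ⊗ b b' only on A ⊗ [L, L]; the difference kills that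
      -- subspace, hence raises its filtration by any amount.
      refine Submodule.mem_sup.mpr ⟨_, h1, _, mem_shiftSub_of_eq_zero (f := _ - _) ?_ 1,
        add_sub_cancel _ _⟩
      intro a v hv
      simp only [LinearMap.sub_apply, Module.End.mul_apply, TensorProduct.map_tmul,
        LinearMap.comp_apply, Derivation.coeFn_coe, Derivation.commutator_apply,
        TensorProduct.sub_tmul]
      rw [centroid_comm hb' hb hv, sub_self]

variable (K A L) in
/-- The derivations of `A ⊗ L` which vanish on `A ⊗ [L, L]` and raise the filtration by the
subspaces `J ^ p ⊗ L + A ⊗ Z(L)` by `k` steps. -/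
def vanishingSub (k : ℕ) : Submodule K (Module.End K (A ⊗[K] L)) where
  carrier := {f | (∀ z ∈ tensorSub ⊤ (derivedSub K L), f z = 0) ∧
    ∀ p, ∀ z ∈ centralFil K A L p, f z ∈ centralFil K A L (p + k)}
  add_mem' hf hg := ⟨fun z hz => by rw [LinearMap.add_apply, hf.1 z hz, hg.1 z hz, add_zero],
    fun p z hz => add_mem (hf.2 p z hz) (hg.2 p z hz)⟩
  zero_mem' := ⟨fun z _ => rfl, fun p z _ => zero_mem _⟩
  smul_mem' r f hf := ⟨fun z hz => by rw [LinearMap.smul_apply, hf.1 z hz, smul_zero],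
    fun p z hz => Submodule.smul_mem _ r (hf.2 p z hz)⟩

theorem commutator_mem_vanishingSub {k : ℕ} {f g : Module.End K (A ⊗[K] L)}
    (hf : f ∈ vanishingSub K A L (k + 1)) (hg : g ∈ vanishingSub K A L (k + 1)) :
    f * g - g * f ∈ vanishingSub K A L (k + 1 + 1) := by
  refine ⟨fun z hz => ?_, fun p z hz => ?_⟩
  · simp [hf.1 z hz, hg.1 z hz]
  · exact sub_mem (centralFil_anti (by omega) (hf.2 _ _ (hg.2 p z hz)))
      (centralFil_anti (by omega) (hg.2 _ _ (hf.2 p z hz)))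

variable [CharZero K] [FiniteDimensional K A]

theorem derCentroidSub_le_shiftSub (k : ℕ) : derCentroidSub K A L k ≤ shiftSub K A L 0 := by
  rw [derCentroidSub, Submodule.span_le]
  rintro _ ⟨d, -, b, hb, rfl⟩ p z hz
  have : tensorSub (nilPow K A p) (derivedSub K L) ≤
      (tensorSub (nilPow K A p) (derivedSub K L)).comap (TensorProduct.map (d : A →ₗ[K] A) b) :=
    tensorSub_le.mpr fun a ha v hv => by
      rw [Submodule.mem_comap, TensorProduct.map_tmul]
      exact tmul_mem_tensorSub (derivation_apply_mem_nilradical_pow d p ha)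
        (centroid_mem_derivedSub hb hv)
  exact this hz

theorem commutator_mem_sup_shiftSub {k : ℕ} {f g : Module.End K (A ⊗[K] L)}
    (hf : f ∈ derCentroidSub K A L k ⊔ shiftSub K A L 1)
    (hg : g ∈ derCentroidSub K A L k ⊔ shiftSub K A L 1) :
    f * g - g * f ∈ derCentroidSub K A L (k + 1) ⊔ shiftSub K A L 1 := by
  obtain ⟨t, ht, n, hn, rfl⟩ := Submodule.mem_sup.mp hf
  obtain ⟨t', ht', n', hn', rfl⟩ := Submodule.mem_sup.mp hg
  have h1 := commutator_mem_derCentroidSub ht ht'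
  have h2 := commutator_mem_shiftSub (derCentroidSub_le_shiftSub k ht) hn'
  have h3 := commutator_mem_shiftSub hn (derCentroidSub_le_shiftSub k ht')
  have h4 := shiftSub_anti (by omega) (commutator_mem_shiftSub hn hn') (j := 1)
  have : (t + n) * (t' + n') - (t' + n') * (t + n) =
      (t * t' - t' * t) + ((t * n' - n' * t) + (n * t' - t' * n) + (n * n' - n' * n)) := by
    noncomm_ring
  rw [this]
  exact add_mem h1 (Submodule.mem_sup_right (add_mem (add_mem h2 h3) h4))

variable [FiniteDimensional K L]

variable (K A L) in
/-- The elements of `centralDer` which lie in a given space of operators. -/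
def centralDerIn (V : Submodule K (Module.End K (A ⊗[K] L))) :
    Submodule K (LieDerivation K (A ⊗[K] L) (A ⊗[K] L)) where
  carrier := {D | D ∈ centralDer K A L ∧ D.toLinearMap ∈ V}
  add_mem' hD hE := ⟨add_mem hD.1 hE.1, V.add_mem hD.2 hE.2⟩
  zero_mem' := ⟨zero_mem _, V.zero_mem⟩
  smul_mem' r _ hD := ⟨(centralDer K A L).smul_mem r hD.1, V.smul_mem r hD.2⟩

theorem lie_mem_centralDerIn {V W : Submodule K (Module.End K (A ⊗[K] L))}
    (h : ∀ f ∈ V, ∀ g ∈ V, f * g - g * f ∈ W) {D E : LieDerivation K (A ⊗[K] L) (A ⊗[K] L)}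
    (hD : D ∈ centralDerIn K A L V) (hE : E ∈ centralDerIn K A L V) :
    ⁅D, E⁆ ∈ centralDerIn K A L W :=
  ⟨(centralDer K A L).lie_mem hE.1, h _ hD.2 _ hE.2⟩

/-- Applying D to the bracket of a ⊗ x and 1 ⊗ y gives zero, so ⁅D (a ⊗ x), 1 ⊗ y⁆ = -a • ⁅1 ⊗ x, D
(1 ⊗ y)⁆. The right side gains a factor J because the A ⊗ Z part of D (1 ⊗ y) drops out of brackets.
-/
theorem mem_vanishingSub_one {D : LieDerivation K (A ⊗[K] L) (A ⊗[K] L)} (hD : D ∈ centralDer K A L)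
    (h : ∀ z ∈ tensorSub ⊤ (derivedSub K L), D z = 0) : D.toLinearMap ∈ vanishingSub K A L 1 := by
  refine ⟨h, fun p z hz => ?_⟩
  obtain ⟨u, hu, v, hv, rfl⟩ := Submodule.mem_sup.mp hz
  change D (u + v) ∈ centralFil K A L (p + 1)
  rw [map_add]
  refine add_mem ?_ (map_center_mem_centralFil D hv _)
  have : tensorSub (nilPow K A p) ⊤ ≤
      (centralFil K A L (p + 1)).comap (D : A ⊗[K] L →ₗ[K] A ⊗[K] L) :=
    tensorSub_le.mpr fun a ha x _ => by
      change D (a ⊗ₜ[K] x) ∈ centralFil K A L (p + 1)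
      refine mem_centralFil_of_lie fun y => ?_
      have h1 := LieDerivation.apply_lie_eq_add D (a ⊗ₜ[K] x) ((1 : A) ⊗ₜ[K] y)
      rw [LieAlgebra.ExtendScalars.bracket_tmul,
        h _ (tmul_mem_tensorSub trivial (lie_mem_derivedSub x y))] at h1
      rw [eq_neg_of_add_eq_zero_right h1.symm, tmul_eq_smul a x, smul_lie]
      refine neg_mem (smul_mem_tensorSub ha ?_)
      rw [← lie_skew]
      exact neg_mem (Submodule.map₂_le_map₂_right le_top (lie_mem_of_mem_centralFil (hD _) _))
  exact this hu

/-- Subtracting the defect leaves a ⊗ v ↦ a • D (1 ⊗ v). For v in [L, L] the Leibniz rule puts D (1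
⊗ v) in J ⊗ [L, L], as central parts of values of D vanish in brackets. -/
theorem mem_derCentroidSub_sup_shiftSub {D : LieDerivation K (A ⊗[K] L) (A ⊗[K] L)}
    (hD : D ∈ centralDer K A L) :
    D.toLinearMap ∈ derCentroidSub K A L 0 ⊔ shiftSub K A L 1 := by
  obtain ⟨n, d, b, hb, h⟩ := exists_defect_eq_sum D
  let t : Module.End K (A ⊗[K] L) := ∑ j, TensorProduct.map (d j : A →ₗ[K] A) (b j)
  have ht : t ∈ derCentroidSub K A L 0 :=
    sum_mem fun j _ => Submodule.subset_span ⟨d j, trivial, b j, hb j, rfl⟩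
  refine Submodule.mem_sup.mpr ⟨t, ht, D.toLinearMap - t, fun p z hz => ?_, add_sub_cancel _ _⟩
  have h1 : ∀ v ∈ derivedSub K L,
      D ((1 : A) ⊗ₜ[K] v) ∈ tensorSub (nilPow K A 1) (derivedSub K L) := by
    intro v hv
    refine derivedSub_le (W := (tensorSub (nilPow K A 1) (derivedSub K L)).comap
      ((D : A ⊗[K] L →ₗ[K] A ⊗[K] L) ∘ₗ TensorProduct.mk K A L 1)) (fun x y => ?_) hv
    change D ((1 : A) ⊗ₜ[K] ⁅x, y⁆) ∈ tensorSub (nilPow K A 1) (derivedSub K L)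
    rw [← mul_one (1 : A), ← LieAlgebra.ExtendScalars.bracket_tmul,
      LieDerivation.apply_lie_eq_add, ← lie_skew]
    exact add_mem (neg_mem (lie_mem_of_mem_centralFil (hD _) _))
      (lie_mem_of_mem_centralFil (hD _) _)
  have : tensorSub (nilPow K A p) (derivedSub K L) ≤
      (tensorSub (nilPow K A (p + 1)) (derivedSub K L)).comap (D.toLinearMap - t) :=
    tensorSub_le.mpr fun a ha v hv => by
      have h2 : (D.toLinearMap - t) (a ⊗ₜ[K] v) = a • D ((1 : A) ⊗ₜ[K] v) := by
        rw [LinearMap.sub_apply, sub_eq_iff_eq_add]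
        refine (apply_tmul_eq D a v).trans ?_
        rw [h a v hv, LinearMap.sum_apply]
        rfl
      rw [Submodule.mem_comap, h2]
      exact smul_mem_tensorSub ha (h1 v hv)
  exact this hz

theorem solvableChain_centralDer (hcenter : centerSub K L ≤ derivedSub K L)
    (hsolv : LieAlgebra.IsSolvable (Derivation K A A)) :
    SolvableChain (centralDer K A L).toSubmodule := by
  have : IsArtinianRing A := IsArtinianRing.of_finite K A
  obtain ⟨m, hm⟩ := IsArtinianRing.isNilpotent_nilradical (R := A)
  obtain ⟨n, hn⟩ := LieAlgebra.IsSolvable.solvable K (Derivation K A A)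
  have hnil (p : ℕ) : nilPow K A (p + m) = ⊥ := by
    ext a
    simp [pow_add, hm]
  have hV : SolvableChain (centralDerIn K A L (vanishingSub K A L 1)) := by
    refine SolvableChain.of_sequence
      (U := fun k => centralDerIn K A L (vanishingSub K A L (k + 1))) (n := m) ?_
      fun k x hx y hy => lie_mem_centralDerIn (fun f hf g hg => commutator_mem_vanishingSub hf hg)
        hx hy
    -- J ^ (m + 1) = 0, so values of D and E lie in A ⊗ Z ⊆ A ⊗ [L, L], where both derivations
    -- vanish.
    refine .step .bot fun D hD E hE => ?_
    have hval : ∀ D ∈ centralDerIn K A L (vanishingSub K A L (m + 1)), ∀ z,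
        D z ∈ tensorSub ⊤ (derivedSub K L) := by
      intro D hD z
      have h1 : D z ∈ centralFil K A L (0 + (m + 1)) :=
        hD.2.2 0 z (by rw [centralFil_zero]; trivial)
      rw [centralFil, show 0 + (m + 1) = 1 + m by omega, hnil, tensorSub, Submodule.map₂_bot_left,
        bot_sup_eq] at h1
      exact Submodule.map₂_le_map₂_right hcenter h1
    rw [Submodule.mem_bot]
    ext z
    rw [LieDerivation.lie_apply, LieDerivation.zero_apply]
    have h1 : D (E z) = 0 := hD.2.1 _ (hval E hE z)
    have h2 : E (D z) = 0 := hE.2.1 _ (hval D hD z)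
    rw [h1, h2, sub_zero]
  have hN : SolvableChain (centralDerIn K A L (shiftSub K A L 1)) := by
    refine SolvableChain.of_sequence
      (U := fun k => centralDerIn K A L (shiftSub K A L (k + 1))) (n := m) ?_
      fun k x hx y hy => lie_mem_centralDerIn (fun f hf g hg =>
        shiftSub_anti (by omega) (commutator_mem_shiftSub hf hg)) hx hy
    -- Raising the filtration by m + 1 steps means vanishing on A ⊗ [L, L].
    refine hV.mono fun D hD => ⟨hD.1, mem_vanishingSub_one hD.1 fun z hz => ?_⟩
    have h1 : D z ∈ tensorSub (nilPow K A (0 + (m + 1))) (derivedSub K L) :=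
      hD.2 0 z (by rwa [nilPow_zero])
    rwa [show 0 + (m + 1) = 1 + m by omega, hnil, tensorSub, Submodule.map₂_bot_left,
      Submodule.mem_bot] at h1
  have hU : SolvableChain (centralDerIn K A L (derCentroidSub K A L 0 ⊔ shiftSub K A L 1)) := by
    refine SolvableChain.of_sequence
      (U := fun k => centralDerIn K A L (derCentroidSub K A L k ⊔ shiftSub K A L 1)) (n := n) ?_
      fun k x hx y hy => lie_mem_centralDerIn (fun f hf g hg => commutator_mem_sup_shiftSub hf hg)
        hx hy
    have h0 : derCentroidSub K A L n = ⊥ := by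
      rw [derCentroidSub, Submodule.span_eq_bot]
      rintro _ ⟨d, hd, b, -, rfl⟩
      rw [hn, LieSubmodule.mem_bot] at hd
      rw [hd, Derivation.coe_zero_linearMap, TensorProduct.map_zero_left]
    rwa [h0, bot_sup_eq]
  exact hU.mono fun D hD => ⟨hD, mem_derCentroidSub_sup_shiftSub hD⟩

end CentralDerSolvable

/-! ### Characters and trivial radicals -/

section Semisimple

/-- The Jacobson radical of S is zero, so some maximal ideal misses a; its residue field is K
because K is algebraically closed. -/
theorem exists_algHom_apply_ne_zero {K S : Type*} [Field K] [IsAlgClosed K] [CommRing S]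
    [Algebra K S] [FiniteDimensional K S] [IsSemisimpleRing S] {a : S} (ha : a ≠ 0) :
    ∃ χ : S →ₐ[K] K, χ a ≠ 0 := by
  have h : a ∉ Ring.jacobson S := by
    rwa [Ring.jacobson, IsSemisimpleModule.jacobson_eq_bot, Submodule.mem_bot]
  rw [Ring.jacobson_eq_sInf_isMaximal, Submodule.mem_sInf] at h
  obtain ⟨m : Ideal S, hm : m.IsMaximal, ham⟩ : ∃ m : Ideal S, m.IsMaximal ∧ a ∉ m := by
    by_contra! hcon
    exact h hcon
  let _ := Ideal.Quotient.field m
  let e : K ≃ₐ[K] S ⧸ m := AlgEquiv.ofBijective (Algebra.ofId K (S ⧸ m))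
    (IsAlgClosed.algebraMap_bijective_of_isIntegral)
  refine ⟨e.symm.toAlgHom.comp (Ideal.Quotient.mkₐ K m), fun h0 => ham ?_⟩
  have : e.symm (Ideal.Quotient.mk m a) = 0 := h0
  rwa [EmbeddingLike.map_eq_zero_iff, Ideal.Quotient.eq_zero_iff_mem] at this

/-- Evaluation of a character of `S` on the first tensor factor of `S ⊗ L`. -/
noncomputable def evalHom {K S L : Type*} [Field K] [CommRing S] [Algebra K S] [LieRing L]
    [LieAlgebra K L] (χ : S →ₐ[K] K) : S ⊗[K] L →ₗ⁅K⁆ L where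
  toLinearMap := slice χ.toLinearMap
  map_lie' {x y} := by
    change slice χ.toLinearMap ⁅x, y⁆ = ⁅slice χ.toLinearMap x, slice χ.toLinearMap y⁆
    induction x using TensorProduct.induction_on with
    | zero => simp
    | add u v hu hv => simp only [add_lie, map_add, hu, hv]
    | tmul a x =>
      induction y using TensorProduct.induction_on with
      | zero => simp
      | add u v hu hv => simp only [lie_add, map_add, hu, hv]
      | tmul b y =>
        simp [LieAlgebra.ExtendScalars.bracket_tmul, mul_smul, smul_comm (χ a)]

theorem evalHom_tmul {K S L : Type*} [Field K] [CommRing S] [Algebra K S] [LieRing L]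
    [LieAlgebra K L] (χ : S →ₐ[K] K) (a : S) (x : L) : evalHom χ (a ⊗ₜ[K] x) = χ a • x :=
  slice_tmul χ.toLinearMap a x

theorem evalHom_surjective {K S L : Type*} [Field K] [CommRing S] [Algebra K S] [LieRing L]
    [LieAlgebra K L] (χ : S →ₐ[K] K) : Function.Surjective (evalHom χ : S ⊗[K] L →ₗ⁅K⁆ L) :=
  fun x => ⟨1 ⊗ₜ x, by rw [evalHom_tmul, map_one, one_smul]⟩

theorem eq_zero_of_evalHom {K S L : Type*} [Field K] [IsAlgClosed K] [CommRing S] [Algebra K S]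
    [FiniteDimensional K S] [IsSemisimpleRing S] [LieRing L] [LieAlgebra K L] {z : S ⊗[K] L}
    (h : ∀ χ : S →ₐ[K] K, evalHom χ z = 0) : z = 0 := by
  classical
  let c := Module.Basis.ofVectorSpace K L
  apply (TensorProduct.equivFinsuppOfBasisRight (M := S) c).injective
  ext i
  rw [map_zero, Finsupp.zero_apply]
  by_contra hne
  obtain ⟨χ, hχ⟩ := exists_algHom_apply_ne_zero (K := K) hne
  apply hχ
  have key : ∀ w : S ⊗[K] L,
      χ (TensorProduct.equivFinsuppOfBasisRight c w i) = c.repr (evalHom χ w) i := by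
    intro w
    induction w using TensorProduct.induction_on with
    | zero => simp
    | add u v hu hv => simp only [map_add, Finsupp.add_apply, hu, hv]
    | tmul a x => simp [evalHom_tmul, TensorProduct.equivFinsuppOfBasisRight_apply_tmul, mul_comm]
  rw [key, h χ]
  simp

/-- A Lie algebra which embeds into a product of Lie algebras with trivial radical, with
surjective projections, has trivial radical. -/
theorem hasTrivialRadical_of_family {K T M ι : Type*} [Field K] [LieRing T] [LieAlgebra K T]
    [LieRing M] [LieAlgebra K M] [LieAlgebra.HasTrivialRadical K M] (ψ : ι → T →ₗ⁅K⁆ M)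
    (hsurj : ∀ i, Function.Surjective (ψ i)) (hinj : ∀ t, (∀ i, ψ i t = 0) → t = 0) :
    LieAlgebra.HasTrivialRadical K T := by
  rw [LieAlgebra.hasTrivialRadical_iff_no_abelian_ideals]
  intro I hI
  rw [LieSubmodule.eq_bot_iff]
  refine fun t ht => hinj t fun i => ?_
  have hab : IsLieAbelian (I.map (ψ i)) := by
    rw [LieSubmodule.lie_abelian_iff_lie_self_eq_bot] at hI ⊢
    rw [← LieIdeal.map_bracket_eq _ (hsurj i), hI, LieIdeal.map_eq_bot_iff]
    exact bot_le
  have hbot := (LieAlgebra.hasTrivialRadical_iff_no_abelian_ideals K M).mp ‹_› _ hab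
  have := LieIdeal.mem_map (f := ψ i) ht
  rwa [hbot, LieSubmodule.mem_bot] at this

/-- The intersection is an ideal of T that embeds into the solvable radical of P. -/
theorem disjoint_radical_of_hasTrivialRadical {K P : Type*} [Field K] [LieRing P]
    [LieAlgebra K P] [IsNoetherian K P] (T : LieSubalgebra K P) [LieAlgebra.HasTrivialRadical K T] :
    Disjoint T.toSubmodule (LieAlgebra.radical K P).toSubmodule := by
  let I : LieIdeal K T := (LieAlgebra.radical K P).comap T.incl
  let f : I →ₗ⁅K⁆ LieAlgebra.radical K P :=
    { toFun := fun x => ⟨x.1.1, LieIdeal.mem_comap.mp x.2⟩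
      map_add' := fun _ _ => rfl
      map_smul' := fun _ _ => rfl
      map_lie' := rfl }
  have hf : Function.Injective f := fun x y hxy =>
    Subtype.ext (Subtype.ext (congrArg (fun w : LieAlgebra.radical K P => (w : P)) hxy))
  have : LieAlgebra.IsSolvable I := hf.lieAlgebra_isSolvable
  have hI := LieAlgebra.HasTrivialRadical.eq_bot_of_isSolvable I
  rw [Submodule.disjoint_def]
  intro x hxT hxR
  have hx : (⟨x, hxT⟩ : T) ∈ I := LieIdeal.mem_comap.mpr hxR
  rw [hI, LieSubmodule.mem_bot] at hx
  exact congrArg Subtype.val hx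

end Semisimple

/-! ### The radical of Der(A ⊗ L) and its complement -/

section Main

variable {K A L : Type*} [Field K] [CommRing A] [Algebra K A] [LieRing L] [LieAlgebra K L]

theorem lie_mem_tensorSub_ideal {I J : LieIdeal K L} {z w : A ⊗[K] L}
    (hz : z ∈ tensorSub ⊤ I.toSubmodule) (hw : w ∈ tensorSub ⊤ J.toSubmodule) :
    ⁅z, w⁆ ∈ tensorSub ⊤ (⁅I, J⁆ : LieIdeal K L).toSubmodule := by
  have h1 : ∀ (a : A), ∀ x ∈ I, ∀ w ∈ tensorSub (⊤ : Submodule K A) J.toSubmodule,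
      ⁅(a ⊗ₜ[K] x : A ⊗[K] L), w⁆ ∈ tensorSub ⊤ (⁅I, J⁆ : LieIdeal K L).toSubmodule := by
    intro a x hx w hw
    have : tensorSub ⊤ J.toSubmodule ≤ (tensorSub ⊤ (⁅I, J⁆ : LieIdeal K L).toSubmodule).comap
        (LieAlgebra.ad K (A ⊗[K] L) (a ⊗ₜ[K] x)) := tensorSub_le.mpr fun b _ y hy => by
      rw [Submodule.mem_comap, LieAlgebra.ad_apply, LieAlgebra.ExtendScalars.bracket_tmul]
      exact tmul_mem_tensorSub trivial (LieSubmodule.lie_mem_lie hx hy)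
    exact this hw
  have : tensorSub ⊤ I.toSubmodule ≤ (tensorSub ⊤ (⁅I, J⁆ : LieIdeal K L).toSubmodule).comap
      (LieAlgebra.ad K (A ⊗[K] L) w) := tensorSub_le.mpr fun a _ x hx => by
    rw [Submodule.mem_comap, LieAlgebra.ad_apply, ← lie_skew]
    exact neg_mem (h1 a x hx w hw)
  rw [← lie_skew]
  exact neg_mem (this hz)

variable (A) in
/-- The image of `A ⊗ I` in the derivations of `A ⊗ L`, for an ideal `I` of `Der L`. -/
noncomputable def tensorDerSub (I : LieIdeal K (LieDerivation K L L)) :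
    Submodule K (LieDerivation K (A ⊗[K] L) (A ⊗[K] L)) :=
  (tensorSub ⊤ I.toSubmodule).map (tensorDer K A L).toLinearMap

theorem tmulDer_mem_tensorDerSub {I : LieIdeal K (LieDerivation K L L)} (a : A)
    {D : LieDerivation K L L} (hD : D ∈ I) : tmulDer a D ∈ tensorDerSub A I :=
  ⟨a ⊗ₜ[K] D, tmul_mem_tensorSub trivial hD, rfl⟩

theorem lie_mem_tensorDerSub {I J : LieIdeal K (LieDerivation K L L)}
    {D E : LieDerivation K (A ⊗[K] L) (A ⊗[K] L)} (hD : D ∈ tensorDerSub A I)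
    (hE : E ∈ tensorDerSub A J) : ⁅D, E⁆ ∈ tensorDerSub A ⁅I, J⁆ := by
  obtain ⟨z, hz, rfl⟩ := hD
  obtain ⟨w, hw, rfl⟩ := hE
  exact ⟨⁅z, w⁆, lie_mem_tensorSub_ideal hz hw, LieHom.map_lie (tensorDer K A L) z w⟩

/-- Evaluating at 1 ⊗ x and slicing along μ composed with a linear projection of A onto S recovers
every slice of the preimage. -/
theorem tensorDerRestrict_injective [FiniteDimensional K A] (S : Subalgebra K A)
    (𝔰 : LieSubalgebra K (LieDerivation K L L)) :
    Function.Injective (tensorDerRestrict S 𝔰) := by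
  rw [injective_iff_map_eq_zero]
  intro z hz
  obtain ⟨π, hπ⟩ := (Subalgebra.toSubmodule S).subtype.exists_leftInverse_of_injective
    (Submodule.ker_subtype _)
  apply eq_zero_of_slice
  intro μ
  have key : ∀ (w : S ⊗[K] 𝔰) (x : L), slice (μ ∘ₗ π) (tensorDerRestrict S 𝔰 w (1 ⊗ₜ[K] x)) =
      ((slice μ w : 𝔰) : LieDerivation K L L) x := by
    intro w x
    induction w using TensorProduct.induction_on with
    | zero => simp
    | add u v hu hv => simp only [map_add, LieDerivation.add_apply, hu, hv]; rfl
    | tmul a D =>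
      have h1 : π (a : A) = a := LinearMap.congr_fun hπ a
      rw [tensorDerRestrict_tmul, slice_tmul, slice_tmul, mul_one, LinearMap.comp_apply, h1]
      rfl
  apply Subtype.ext
  ext x
  rw [← key, hz]
  simp

variable [FiniteDimensional K A]

theorem nilPow_one_eq_jacobson : nilPow K A 1 = (Ring.jacobson A).restrictScalars K := by
  have : IsArtinianRing A := IsArtinianRing.of_finite K A
  rw [nilPow, pow_one, Ring.jacobson_eq_nilradical_of_krullDimLE_zero]

theorem hasTrivialRadical_range [IsAlgClosed K] (S : Subalgebra K A) [IsSemisimpleRing S]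
    (𝔰 : LieSubalgebra K (LieDerivation K L L)) [LieAlgebra.HasTrivialRadical K 𝔰] :
    LieAlgebra.HasTrivialRadical K (tensorDerRestrict S 𝔰).range := by
  have hinj := tensorDerRestrict_injective S 𝔰
  let e := LieEquiv.ofInjective (tensorDerRestrict S 𝔰) hinj
  exact hasTrivialRadical_of_family
    (fun χ : S →ₐ[K] K => (evalHom χ).comp e.symm.toLieHom)
    (fun χ => (evalHom_surjective χ).comp e.symm.surjective)
    fun t ht => (EmbeddingLike.map_eq_zero_iff (f := e.symm)).mp
      (eq_zero_of_evalHom ht)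

variable [FiniteDimensional K L] [CharZero K]

theorem tensorDerSub_top_sup_centralDer :
    tensorDerSub A ⊤ ⊔ (centralDer K A L).toSubmodule = ⊤ := by
  rw [eq_top_iff]
  intro D _
  have h := sub_sum_mem_centralDer D (Module.finBasis K A)
  rw [← add_sub_cancel (∑ i, tmulDer (Module.finBasis K A i)
    (sliceDer ((Module.finBasis K A).coord i) D)) D]
  exact Submodule.add_mem_sup (sum_mem fun i _ => tmulDer_mem_tensorDerSub _ trivial) h

theorem lie_mem_tensorDerSub_sup {I J M : LieIdeal K (LieDerivation K L L)} (h : ⁅I, J⁆ ≤ M)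
    {D E : LieDerivation K (A ⊗[K] L) (A ⊗[K] L)}
    (hD : D ∈ tensorDerSub A I ⊔ (centralDer K A L).toSubmodule)
    (hE : E ∈ tensorDerSub A J ⊔ (centralDer K A L).toSubmodule) :
    ⁅D, E⁆ ∈ tensorDerSub A M ⊔ (centralDer K A L).toSubmodule := by
  obtain ⟨D₁, hD₁, D₂, hD₂, rfl⟩ := Submodule.mem_sup.mp hD
  obtain ⟨E₁, hE₁, E₂, hE₂, rfl⟩ := Submodule.mem_sup.mp hE
  rw [add_lie, lie_add, add_assoc]
  refine Submodule.add_mem_sup (Submodule.map_mono (Submodule.map₂_le_map₂_right h)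
    (lie_mem_tensorDerSub hD₁ hE₁)) (add_mem ?_ ?_)
  · exact (centralDer K A L).lie_mem hE₂
  · rw [← lie_skew]
    exact neg_mem ((centralDer K A L).lie_mem hD₂)

variable (K A L) in
/-- The ideal of `Der (A ⊗ L)` which is the sum of `centralDer` and the image of `A ⊗ 𝔯`, with `𝔯` the
radical of `Der L`. -/
noncomputable def radicalDer : LieIdeal K (LieDerivation K (A ⊗[K] L) (A ⊗[K] L)) where
  toSubmodule := tensorDerSub A (LieAlgebra.radical K (LieDerivation K L L)) ⊔
    (centralDer K A L).toSubmodule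
  lie_mem {D E} hE := lie_mem_tensorDerSub_sup (I := ⊤) (LieSubmodule.lie_le_right _ _)
    (by rw [tensorDerSub_top_sup_centralDer]; trivial) hE

/-- Modulo the ideal N, brackets in A ⊗ 𝔯 follow the derived series of 𝔯; once that reaches zero,
the chain for N takes over. -/
theorem isSolvable_radicalDer (hcenter : centerSub K L ≤ derivedSub K L)
    (hsolv : LieAlgebra.IsSolvable (Derivation K A A)) :
    LieAlgebra.IsSolvable (radicalDer K A L) := by
  obtain ⟨n, hn⟩ := LieAlgebra.IsSolvable.solvable K
    (LieAlgebra.radical K (LieDerivation K L L))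
  rw [LieIdeal.derivedSeries_eq_bot_iff] at hn
  let U (k : ℕ) := tensorDerSub A (LieAlgebra.derivedSeriesOfIdeal K (LieDerivation K L L) k
    (LieAlgebra.radical K (LieDerivation K L L))) ⊔ (centralDer K A L).toSubmodule
  have hUn : U n = (centralDer K A L).toSubmodule := by
    simp only [U, hn]
    rw [tensorDerSub, LieSubmodule.bot_toSubmodule, tensorSub, Submodule.map₂_bot_right,
      Submodule.map_bot, bot_sup_eq]
  have hstep (k : ℕ) : ∀ D ∈ U k, ∀ E ∈ U k, ⁅D, E⁆ ∈ U (k + 1) := fun D hD E hE =>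
    lie_mem_tensorDerSub_sup
      (LieAlgebra.derivedSeriesOfIdeal_succ _ _ (LieAlgebra.radical K (LieDerivation K L L)) k).ge
      hD hE
  have hU : SolvableChain (U 0) :=
    SolvableChain.of_sequence (hUn.symm ▸ solvableChain_centralDer hcenter hsolv) hstep
  exact hU.isSolvable (radicalDer K A L) le_rfl

theorem radicalDer_le_radical (hcenter : centerSub K L ≤ derivedSub K L)
    (hsolv : LieAlgebra.IsSolvable (Derivation K A A)) :
    radicalDer K A L ≤ LieAlgebra.radical K (LieDerivation K (A ⊗[K] L) (A ⊗[K] L)) :=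
  (LieAlgebra.LieIdeal.solvable_iff_le_radical K (LieDerivation K (A ⊗[K] L) (A ⊗[K] L))
    (radicalDer K A L)).mp (isSolvable_radicalDer hcenter hsolv)

/-- Expanding (S + J) ⊗ (𝔰 + 𝔯), the part S ⊗ 𝔯 lies in A ⊗ 𝔯, and J ⊗ Der L lies in N. -/
theorem range_sup_radicalDer {𝔰 : LieSubalgebra K (LieDerivation K L L)}
    (h𝔰 : IsLeviFactor 𝔰) {S : Subalgebra K A} (hS : IsWedderburnMalcevPart S) :
    (tensorDerRestrict S 𝔰).range.toSubmodule ⊔ (radicalDer K A L).toSubmodule = ⊤ := by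
  have hle : tensorDerSub A ⊤ ≤
      (tensorDerRestrict S 𝔰).range.toSubmodule ⊔ (radicalDer K A L).toSubmodule := by
    rw [tensorDerSub, Submodule.map_le_iff_le_comap, tensorSub_le]
    intro a _ D _
    have ha : a ∈ Subalgebra.toSubmodule S ⊔ (Ring.jacobson A).restrictScalars K := by
      rw [hS.isCompl.sup_eq_top]; trivial
    have hD : D ∈ 𝔰.toSubmodule ⊔ (LieAlgebra.radical K (LieDerivation K L L)).toSubmodule := by
      rw [h𝔰.isCompl.sup_eq_top]; trivial
    obtain ⟨s, hs, j, hj, rfl⟩ := Submodule.mem_sup.mp ha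
    obtain ⟨σ, hσ, ρ, hρ, rfl⟩ := Submodule.mem_sup.mp hD
    rw [TensorProduct.add_tmul, TensorProduct.tmul_add, Submodule.mem_comap, map_add, map_add,
      add_assoc]
    refine Submodule.add_mem_sup ⟨(⟨s, hs⟩ : S) ⊗ₜ[K] (⟨σ, hσ⟩ : 𝔰), rfl⟩ ?_
    rw [← nilPow_one_eq_jacobson] at hj
    exact Submodule.add_mem_sup (tmulDer_mem_tensorDerSub s hρ) (tmulDer_mem_centralDer hj _)
  rw [eq_top_iff, ← tensorDerSub_top_sup_centralDer]
  exact sup_le hle (le_sup_of_le_right le_sup_right)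

theorem isCompl_range_radical [IsAlgClosed K] (hcenter : centerSub K L ≤ derivedSub K L)
    (hsolv : LieAlgebra.IsSolvable (Derivation K A A))
    {𝔰 : LieSubalgebra K (LieDerivation K L L)} (h𝔰 : IsLeviFactor 𝔰) {S : Subalgebra K A}
    (hS : IsWedderburnMalcevPart S) :
    IsCompl (tensorDerRestrict S 𝔰).range.toSubmodule
      (LieAlgebra.radical K (LieDerivation K (A ⊗[K] L) (A ⊗[K] L))).toSubmodule := by
  have := hS.isSemisimpleRing
  have := h𝔰.isSemisimple
  have := hasTrivialRadical_range S 𝔰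
  have hle : (radicalDer K A L).toSubmodule ≤
      (LieAlgebra.radical K (LieDerivation K (A ⊗[K] L) (A ⊗[K] L))).toSubmodule :=
    LieSubmodule.toSubmodule_le_toSubmodule _ _ |>.mpr (radicalDer_le_radical hcenter hsolv)
  refine ⟨disjoint_radical_of_hasTrivialRadical _, codisjoint_iff.mpr (eq_top_iff.mpr ?_)⟩
  rw [← range_sup_radicalDer h𝔰 hS]
  exact sup_le_sup_left hle _

end Main

end CurrentLie

theorem mainTheorem2 {𝔤 A : Type*} [LieRing 𝔤] [LieAlgebra ℂ 𝔤] [FiniteDimensional ℂ 𝔤]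
    [CommRing A] [Algebra ℂ A] [FiniteDimensional ℂ A]
    (hcenter : LieAlgebra.center ℂ 𝔤 ≤ ⁅(⊤ : LieIdeal ℂ 𝔤), (⊤ : LieIdeal ℂ 𝔤)⁆)
    (hsolv : LieAlgebra.IsSolvable (Derivation ℂ A A))
    (𝔰 : LieSubalgebra ℂ (LieDerivation ℂ 𝔤 𝔤)) (h𝔰 : CurrentLie.IsLeviFactor 𝔰)
    (S : Subalgebra ℂ A) (hS : CurrentLie.IsWedderburnMalcevPart S) :
    Function.Injective (CurrentLie.tensorDerRestrict S 𝔰) ∧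
      CurrentLie.IsLeviFactor (CurrentLie.tensorDerRestrict S 𝔰).range := by
  have := hS.isSemisimpleRing
  have := h𝔰.isSemisimple
  have htriv := CurrentLie.hasTrivialRadical_range S 𝔰
  -- Semisimplicity comes from `htriv`: in finite dimension and characteristic zero, trivial radical
  -- suffices.
  exact ⟨CurrentLie.tensorDerRestrict_injective S 𝔰, inferInstance,
    CurrentLie.isCompl_range_radical hcenter hsolv h𝔰 hS⟩
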